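/- Let $n_{\mathcal Q}\ge 1$ be an integer and $k_0>0$. Let $S=\{k\in\mathbb C:\ \mathrm{Re}\,k>0,\ |\mathrm{Im}\,k|<\tfrac{\pi}{2n_{\mathcal Q}}\}$, and let $w_0(\cdot,k_0)$ be the harmonic measure of $S\setminus([0,k_0]\times\{0\})$, that is, the unique function on $\overline S$ which is bounded and harmonic in $S\setminus([0,k_0]\times\{0\})$, continuous on $\overline S\setminus\{0\}$, equal to $0$ on $\partial S$ and equal to $1$ on $(0,k_0]\times\{0\}$ (such a function exists and is unique). Then for all real $k>0$ $$w_0(k,k_0)\ \ge\ \frac{6}{\pi}\,\eta(k_0)\,e^{-n_{\mathcal Q}k},\qquad \eta(k_0)=\frac{(e^{k_0}-1)^{n_{\mathcal Q}}}{1+2\sqrt{1+(e^{k_0}-1)^{2n_{\mathcal Q}}}}.$$ -/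

import Mathlib

/-- The open half-strip `Re k > 0`, `|Im k| < π / (2 n)` in the complex plane. -/
def halfStrip (n : ℕ) : Set ℂ :=
  {k : ℂ | 0 < k.re ∧ |k.im| < Real.pi / (2 * (n : ℝ))}

/-- The slit `[0, k₀] × {0}`. -/
def slit (k₀ : ℝ) : Set ℂ :=
  {k : ℂ | 0 ≤ k.re ∧ k.re ≤ k₀ ∧ k.im = 0}

/-- `w` is the harmonic measure of the slit half-strip `halfStrip n \ slit k₀`: the bounded solution
of the Dirichlet problem with boundary values `0` on the boundary of the half-strip and `1` on the
slit `(0, k₀] × {0}`. The boundary values jump at the point `0`, where the slit meets the boundary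
of the half-strip, so `w` attains its boundary values continuously at all points except `0`.
The values of `w` outside the closed half-strip are irrelevant. -/
structure IsHarmonicMeasure (n : ℕ) (k₀ : ℝ) (w : ℂ → ℝ) : Prop where
  harmonic : InnerProductSpace.HarmonicOnNhd w (halfStrip n \ slit k₀)
  continuousOn : ContinuousOn w (closure (halfStrip n) \ {0})
  bounded : ∃ M : ℝ, ∀ k ∈ halfStrip n \ slit k₀, |w k| ≤ M
  eq_zero : ∀ k ∈ frontier (halfStrip n), w k = 0
  eq_one : ∀ k ∈ slit k₀ \ {0}, w k = 1

/-- `η(k₀) = x / (1 + 2 √(1 + x²))` at `x = (e ^ k₀ - 1) ^ n`. -/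
noncomputable def eta (n : ℕ) (k₀ : ℝ) : ℝ :=
  (Real.exp k₀ - 1) ^ n / (1 + 2 * √(1 + (Real.exp k₀ - 1) ^ (2 * n)))

open Complex hiding eta
open Filter Topology InnerProductSpace

/-! The harmonic measure is explicit. The map `sinh (n k)` sends the half-strip to the right
half-plane and the slit to a real segment ending at `0`; `z = sinh (n k₀) / sinh (n k)` turns that
segment into the ray `[1, ∞)`, and `arcsin` opens the cut half-plane to the strip `0 < Re < π/2`.
Hence `w₀ = (2/π) Re arcsin z` (`isHarmonicMeasure_slitHarmonicMeasure`).

Uniqueness is a Phragmén–Lindelöf argument (`nonpos_of_harmonicOnNhd_slit_halfStrip`): boundedness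
replaces boundary control at `0` and at infinity.

For `k ≥ k₀`, `arcsin t ≥ t` gives `w₀ ≥ (2/π) sinh (n k₀) / sinh (n k)`, and it remains to use `η ≤
(e^k₀ - 1)^n / 3 ≤ 2 sinh (n k₀) / 3` and `2 sinh (n k) ≤ e^(n k)`. For `k ≤ k₀`, `w₀ = 1`, while `η
≤ 1/2` makes the bound at most `3/π < 1`. -/

/-- At a local maximum the second derivative is nonpositive. -/
theorem IsLocalMax.deriv_deriv_nonpos {g : ℝ → ℝ} {a : ℝ} (h : IsLocalMax g a)
    (hc : ContinuousAt g a) : deriv (deriv g) a ≤ 0 := by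
  by_contra! hpos
  have hmin := isLocalMin_of_deriv_deriv_pos hpos h.deriv_eq_zero hc
  have hconst : g =ᶠ[𝓝 a] fun _ => g a := by
    filter_upwards [h, hmin] with x h₁ h₂ using le_antisymm h₁ h₂
  have hd : deriv (deriv g) a = 0 := by
    rw [hconst.deriv.deriv_eq]
    simp
  exact hpos.ne' hd

/-- First derivative of a function along a line. -/
theorem hasDerivAt_comp_line {f : ℂ → ℝ} {q e : ℂ} {t : ℝ}
    (hf : DifferentiableAt ℝ f (q + t • e)) :
    HasDerivAt (fun s : ℝ => f (q + s • e)) (fderiv ℝ f (q + t • e) e) t := by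
  have hl : HasDerivAt (fun s : ℝ => q + s • e) e t := by
    simpa using ((hasDerivAt_id t).smul_const e).const_add q
  exact hf.hasFDerivAt.comp_hasDerivAt t hl

theorem tendsto_line_zero (q e : ℂ) : Tendsto (fun s : ℝ => q + s • e) (𝓝 0) (𝓝 q) := by
  have : Continuous fun s : ℝ => q + s • e := by fun_prop
  simpa using this.tendsto 0

theorem eventually_deriv_comp_line {f : ℂ → ℝ} {q : ℂ} (hf : ContDiffAt ℝ 2 f q) (e : ℂ) :
    ∀ᶠ t : ℝ in 𝓝 0,
      HasDerivAt (fun s : ℝ => f (q + s • e)) (fderiv ℝ f (q + t • e) e) t := by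
  have h₁ : ∀ᶠ z in 𝓝 q, ContDiffAt ℝ 2 f z := hf.eventually (by simp)
  filter_upwards [(tendsto_line_zero q e).eventually h₁] with t ht
  exact hasDerivAt_comp_line (ht.differentiableAt (by norm_num))

/-- Second derivative of a function along a line. -/
theorem hasDerivAt_fderiv_comp_line {f : ℂ → ℝ} {q : ℂ} (hf : ContDiffAt ℝ 2 f q) (e : ℂ) :
    HasDerivAt (fun t : ℝ => fderiv ℝ f (q + t • e) e) (iteratedFDeriv ℝ 2 f q ![e, e]) 0 := by
  have hd : DifferentiableAt ℝ (fderiv ℝ f) q := by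
    have : ContDiffAt ℝ 1 (fderiv ℝ f) q := hf.fderiv_right (by norm_num)
    exact this.differentiableAt (by norm_num)
  have h1 : HasFDerivAt (fun z => fderiv ℝ f z e)
      ((ContinuousLinearMap.apply ℝ ℝ e).comp (fderiv ℝ (fderiv ℝ f) q)) q :=
    (ContinuousLinearMap.apply ℝ ℝ e).hasFDerivAt.comp q hd.hasFDerivAt
  have hl : HasDerivAt (fun s : ℝ => q + s • e) e 0 := by
    simpa using ((hasDerivAt_id (0 : ℝ)).smul_const e).const_add q
  have h2 : iteratedFDeriv ℝ 2 f q ![e, e]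
      = (ContinuousLinearMap.apply ℝ ℝ e).comp (fderiv ℝ (fderiv ℝ f) q) e := by
    rw [iteratedFDeriv_two_apply]
    rfl
  rw [h2]
  exact h1.comp_hasDerivAt_of_eq (0 : ℝ) hl (by simp)

/-- A harmonic function plus a positive multiple of `(Im z) ^ 2` has no local maximum. -/
theorem not_isLocalMax_harmonic_add_im_sq {h : ℂ → ℝ} {q : ℂ} (hh : HarmonicAt h q)
    {ε : ℝ} (hε : 0 < ε) : ¬ IsLocalMax (fun z => h z + ε * z.im ^ 2) q := by
  intro hmax
  have key : ∀ e : ℂ, iteratedFDeriv ℝ 2 h q ![e, e] + 2 * ε * e.im ^ 2 ≤ 0 := by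
    intro e
    set g : ℝ → ℝ := fun t => h (q + t • e) + ε * (q + t • e).im ^ 2 with hg
    have hgmax : IsLocalMax g 0 := by
      have h0 : g 0 = h q + ε * q.im ^ 2 := by simp [hg]
      filter_upwards [(tendsto_line_zero q e).eventually hmax] with t ht
      rw [h0]
      exact ht
    have hpoly : ∀ t : ℝ, HasDerivAt (fun s : ℝ => ε * (q + s • e).im ^ 2)
        (ε * (2 * (q.im + t * e.im) * e.im)) t := by
      intro t
      have h1 : HasDerivAt (fun s : ℝ => q.im + s * e.im) e.im t := by
        simpa using ((hasDerivAt_id t).mul_const e.im).const_add q.im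
      have := (h1.pow 2).const_mul ε
      simpa using this
    have hderiv : ∀ᶠ t : ℝ in 𝓝 0, HasDerivAt g
        (fderiv ℝ h (q + t • e) e + ε * (2 * (q.im + t * e.im) * e.im)) t := by
      filter_upwards [eventually_deriv_comp_line hh.1 e] with t ht
      exact ht.add (hpoly t)
    have hd1 : deriv g =ᶠ[𝓝 0]
        fun t : ℝ => fderiv ℝ h (q + t • e) e + ε * (2 * (q.im + t * e.im) * e.im) :=
      hderiv.mono fun t ht => ht.deriv
    have hlin : HasDerivAt (fun t : ℝ => ε * (2 * (q.im + t * e.im) * e.im))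
        (ε * (2 * e.im * e.im)) 0 := by
      have h1 : HasDerivAt (fun s : ℝ => q.im + s * e.im) e.im 0 := by
        simpa using ((hasDerivAt_id (0 : ℝ)).mul_const e.im).const_add q.im
      exact ((h1.const_mul 2).mul_const e.im).const_mul ε
    have hd2 : deriv (deriv g) 0
        = iteratedFDeriv ℝ 2 h q ![e, e] + ε * (2 * e.im * e.im) := by
      rw [hd1.deriv_eq]
      exact ((hasDerivAt_fderiv_comp_line hh.1 e).add hlin).deriv
    have := hgmax.deriv_deriv_nonpos hderiv.self_of_nhds.continuousAt
    rw [hd2] at this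
    linarith
  have hΔ : iteratedFDeriv ℝ 2 h q ![1, 1] + iteratedFDeriv ℝ 2 h q ![I, I] = 0 := by
    have := hh.2.self_of_nhds
    rw [laplacian_eq_iteratedFDeriv_complexPlane] at this
    simpa using this
  -- Adding the two directions cancels the Laplacian of `h` and leaves `2 ε ≤ 0`.
  have h1 := key 1
  have h2 := key I
  simp only [one_im, I_im] at h1 h2
  linarith

/-! ### Uniqueness: maximum principle on the slit half-strip -/

section Strip

variable {n : ℕ} {k₀ : ℝ}

theorem isOpen_halfStrip (n : ℕ) : IsOpen (halfStrip n) :=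
  (isOpen_lt continuous_const continuous_re).inter
    (isOpen_lt (continuous_abs.comp continuous_im) continuous_const)

theorem isClosed_slit (k₀ : ℝ) : IsClosed (slit k₀) :=
  (isClosed_le continuous_const continuous_re).inter
    ((isClosed_le continuous_re continuous_const).inter
      (isClosed_eq continuous_im continuous_const))

theorem closure_halfStrip_subset (n : ℕ) :
    closure (halfStrip n) ⊆ {k : ℂ | 0 ≤ k.re ∧ |k.im| ≤ Real.pi / (2 * (n : ℝ))} := by
  refine closure_minimal (fun k hk => ⟨hk.1.le, hk.2.le⟩) ?_
  exact (isClosed_le continuous_const continuous_re).inter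
    (isClosed_le (continuous_abs.comp continuous_im) continuous_const)

theorem mem_frontier_halfStrip {k : ℂ} (hk : k ∈ closure (halfStrip n)) (h : k ∉ halfStrip n) :
    k ∈ frontier (halfStrip n) := by
  rw [(isOpen_halfStrip n).frontier_eq]
  exact ⟨hk, h⟩

theorem pi_div_two_mul_le (hn : 1 ≤ n) : Real.pi / (2 * (n : ℝ)) ≤ 2 := by
  have hn' : (1 : ℝ) ≤ n := by exact_mod_cast hn
  rw [div_le_iff₀ (by positivity)]
  nlinarith [Real.pi_le_four]

/-- The harmonic part of the barrier used in the Phragmén–Lindelöf argument. -/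
noncomputable def stripBarrier (k : ℂ) : ℝ := 2 * k.re - Real.log ‖k‖ + 5

theorem harmonicAt_stripBarrier {k : ℂ} (hk : k ≠ 0) : HarmonicAt stripBarrier k := by
  have h1 : HarmonicAt (fun z : ℂ => (2 * z + 5 : ℂ).re) k :=
    AnalyticAt.harmonicAt_re (by fun_prop)
  have h2 : HarmonicAt (fun z : ℂ => Real.log ‖z‖) k :=
    AnalyticAt.harmonicAt_log_norm analyticAt_id hk
  have h3 := h1.sub h2
  have : stripBarrier = (fun z : ℂ => (2 * z + 5 : ℂ).re) - fun z : ℂ => Real.log ‖z‖ := by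
    ext z
    simp [stripBarrier]
    ring
  rwa [this]

theorem continuousAt_stripBarrier {k : ℂ} (hk : k ≠ 0) : ContinuousAt stripBarrier k :=
  (harmonicAt_stripBarrier hk).1.continuousAt

/-- The constant `5` pays for `log ‖k‖ ≤ ‖k‖ - 1 ≤ Re k + 1` and `(Im k)² ≤ 4`. This bound controls
infinity; the next one controls the corner `0`. -/
theorem re_le_stripBarrier_sub {k : ℂ} (hk : k ≠ 0) (hre : 0 ≤ k.re) (him : |k.im| ≤ 2) :
    k.re ≤ stripBarrier k - k.im ^ 2 := by
  have h1 := Real.log_le_sub_one_of_pos (norm_pos_iff.2 hk)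
  have h2 := Complex.norm_le_abs_re_add_abs_im k
  rw [abs_of_nonneg hre] at h2
  have h3 : k.im ^ 2 ≤ 4 := by
    rw [← sq_abs]; nlinarith [abs_nonneg k.im]
  unfold stripBarrier
  linarith

theorem neg_log_le_stripBarrier_sub {k : ℂ} (hre : 0 ≤ k.re) (him : |k.im| ≤ 2) :
    - Real.log ‖k‖ ≤ stripBarrier k - k.im ^ 2 := by
  have h3 : k.im ^ 2 ≤ 4 := by
    rw [← sq_abs]; nlinarith [abs_nonneg k.im]
  unfold stripBarrier
  linarith

/-- Maximum principle: a bounded harmonic function on the slit half-strip whose boundary values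
away from `0` vanish is nonpositive. -/
theorem nonpos_of_harmonicOnNhd_slit_halfStrip (hn : 1 ≤ n) {d : ℂ → ℝ}
    (hd : HarmonicOnNhd d (halfStrip n \ slit k₀))
    (hc : ContinuousOn d (closure (halfStrip n) \ {0}))
    {M : ℝ} (hM : ∀ k ∈ halfStrip n \ slit k₀, d k ≤ M)
    (hz : ∀ k ∈ closure (halfStrip n) \ {0}, k ∉ halfStrip n \ slit k₀ → d k = 0)
    {p : ℂ} (hp : p ∈ halfStrip n \ slit k₀) : d p ≤ 0 := by
  have hne : ∀ k ∈ halfStrip n \ slit k₀, k ≠ 0 := by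
    rintro k hk rfl
    simpa using hk.1.1
  have hcl : ∀ k ∈ closure (halfStrip n), 0 ≤ k.re ∧ |k.im| ≤ 2 := fun k hk =>
    ⟨(closure_halfStrip_subset n hk).1,
      (closure_halfStrip_subset n hk).2.trans (pi_div_two_mul_le hn)⟩
  have hopen : IsOpen (halfStrip n \ slit k₀) := (isOpen_halfStrip n).sdiff (isClosed_slit k₀)
  -- The term `-(Im k)²` makes `d - ε B` strictly subharmonic, which excludes interior maxima.
  set B : ℂ → ℝ := fun k => stripBarrier k - k.im ^ 2 with hB
  have main : ∀ ε : ℝ, 0 < ε → d p ≤ ε * B p := by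
    intro ε hε
    by_contra! hlt
    set φ : ℂ → ℝ := fun k => d k - ε * B k with hφ
    -- With this `R`, `B ≥ R` forces `d ≤ M ≤ ε B`; off the compact set `K` one of the two barrier
    -- bounds gives `B ≥ R`.
    set R : ℝ := M / ε with hR
    set K : Set ℂ := closure (halfStrip n) ∩ {k | Real.exp (-R) ≤ ‖k‖ ∧ k.re ≤ R} with hK
    have hout : ∀ k ∈ halfStrip n \ slit k₀, k ∉ K → φ k ≤ 0 := by
      intro k hk hkK
      have hks := hcl k (subset_closure hk.1)
      have hBR : R ≤ B k := by
        by_cases h1 : Real.exp (-R) ≤ ‖k‖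
        · have h2 : R < k.re := by
            by_contra! h2
            exact hkK ⟨subset_closure hk.1, h1, h2⟩
          exact h2.le.trans (re_le_stripBarrier_sub (hne k hk) hks.1 hks.2)
        · have := Real.log_lt_log (norm_pos_iff.2 (hne k hk)) (not_le.1 h1)
          rw [Real.log_exp] at this
          have h3 := neg_log_le_stripBarrier_sub hks.1 hks.2
          simp only [hB]
          linarith
      have : M ≤ ε * B k := by
        rw [hR, div_le_iff₀ hε] at hBR
        linarith
      have := hM k hk
      simp only [hφ]
      linarith
    have hK0 : ∀ k ∈ K, k ≠ 0 := by
      rintro k hk rfl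
      have := hk.2.1
      rw [norm_zero] at this
      exact absurd this (not_le.2 (Real.exp_pos _))
    have hKc : IsCompact K := by
      refine Metric.isCompact_of_isClosed_isBounded ?_ ?_
      · exact isClosed_closure.inter ((isClosed_le continuous_const continuous_norm).inter
          (isClosed_le continuous_re continuous_const))
      · refine (Metric.isBounded_closedBall (x := (0 : ℂ)) (r := R + 2)).subset ?_
        intro k hk
        rw [mem_closedBall_zero_iff]
        have hks := hcl k hk.1
        have h2 := Complex.norm_le_abs_re_add_abs_im k
        rw [abs_of_nonneg hks.1] at h2
        have := hk.2.2
        linarith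
    have hφc : ContinuousOn φ K := by
      refine (hc.mono fun k hk => ⟨hk.1, hK0 k hk⟩).sub (ContinuousOn.const_mul ?_ ε) |>.congr
        fun _ _ => rfl
      exact fun k hk => ((continuousAt_stripBarrier (hK0 k hk)).sub
        (continuous_im.continuousAt.pow 2)).continuousWithinAt
    have hφp : 0 < φ p := by simp only [hφ]; linarith
    have hpK : p ∈ K := by
      by_contra hpK
      exact absurd (hout p hp hpK) (not_le.2 hφp)
    obtain ⟨q, hqK, hq⟩ := hKc.exists_isMaxOn ⟨p, hpK⟩ hφc
    have hφq : 0 < φ q := hφp.trans_le (hq hpK)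
    have hqΩ : q ∈ halfStrip n \ slit k₀ := by
      by_contra hqΩ
      have h1 := hz q ⟨hqK.1, hK0 q hqK⟩ hqΩ
      have hks := hcl q hqK.1
      have h2 : 0 ≤ B q := hks.1.trans (re_le_stripBarrier_sub (hK0 q hqK) hks.1 hks.2)
      have h3 := mul_nonneg hε.le h2
      simp only [hφ] at hφq
      linarith
    -- Points of the domain outside `K` cannot beat `q`, since `φ ≤ 0 < φ q` there.
    have hmax : IsLocalMax φ q := by
      filter_upwards [hopen.mem_nhds hqΩ] with k hk
      by_cases hkK : k ∈ K
      · exact hq hkK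
      · exact (hout k hk hkK).trans hφq.le
    refine not_isLocalMax_harmonic_add_im_sq
      ((hd q hqΩ).sub ((harmonicAt_stripBarrier (hne q hqΩ)).const_smul (c := ε))) hε ?_
    convert hmax using 2 with k
    simp [hφ, hB]
    ring
  have hlim : Tendsto (fun ε : ℝ => ε * B p) (𝓝[>] 0) (𝓝 0) := by
    have : Tendsto (fun ε : ℝ => ε * B p) (𝓝 0) (𝓝 (0 * B p)) :=
      (continuous_id.mul continuous_const).tendsto 0
    rw [zero_mul] at this
    exact this.mono_left nhdsWithin_le_nhds
  exact ge_of_tendsto hlim (eventually_mem_nhdsWithin.mono fun ε hε => main ε hε)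

theorem IsHarmonicMeasure.le {v w : ℂ → ℝ} (hn : 1 ≤ n) (hv : IsHarmonicMeasure n k₀ v)
    (hw : IsHarmonicMeasure n k₀ w) {p : ℂ} (hp : p ∈ halfStrip n \ slit k₀) : v p ≤ w p := by
  obtain ⟨M₁, h₁⟩ := hv.bounded
  obtain ⟨M₂, h₂⟩ := hw.bounded
  have := nonpos_of_harmonicOnNhd_slit_halfStrip (d := v - w) hn (hv.harmonic.sub hw.harmonic)
    (hv.continuousOn.sub hw.continuousOn) (M := M₁ + M₂) ?_ ?_ hp
  · simpa using this
  · intro k hk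
    have := abs_le.1 (h₁ k hk)
    have := abs_le.1 (h₂ k hk)
    simp only [Pi.sub_apply]
    linarith
  · intro k hk hkΩ
    by_cases hks : k ∈ halfStrip n
    · have hsl : k ∈ slit k₀ \ {0} := ⟨by by_contra h; exact hkΩ ⟨hks, h⟩, hk.2⟩
      simp [hv.eq_one k hsl, hw.eq_one k hsl]
    · have hf := mem_frontier_halfStrip hk.1 hks
      simp [hv.eq_zero k hf, hw.eq_zero k hf]

theorem IsHarmonicMeasure.eqOn_closure {v w : ℂ → ℝ} (hn : 1 ≤ n)
    (hv : IsHarmonicMeasure n k₀ v) (hw : IsHarmonicMeasure n k₀ w) :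
    Set.EqOn v w (closure (halfStrip n)) := by
  intro k hk
  by_cases hks : k ∈ halfStrip n
  · by_cases hsl : k ∈ slit k₀
    · have h : k ∈ slit k₀ \ {0} := ⟨hsl, by rintro rfl; simpa using hks.1⟩
      rw [hv.eq_one k h, hw.eq_one k h]
    · exact le_antisymm (hv.le hn hw ⟨hks, hsl⟩) (hw.le hn hv ⟨hks, hsl⟩)
  · have hf := mem_frontier_halfStrip hk hks
    rw [hv.eq_zero k hf, hw.eq_zero k hf]

end Strip

/-! ### Real part of the complex arcsine -/

/-- The sine of the real part of the complex arcsine of `z`. -/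
noncomputable def sinReArcsin (z : ℂ) : ℝ := 2 * z.re / (‖z + 1‖ + ‖z - 1‖)

theorem two_le_norm_add_one_add_norm_sub_one (z : ℂ) : 2 ≤ ‖z + 1‖ + ‖z - 1‖ := by
  have := norm_sub_le (z + 1) (z - 1)
  have h : (z + 1) - (z - 1) = 2 := by ring
  rw [h] at this
  simpa using this

/-- Continuity holds even across the cuts of `arcsin`, so boundary values on the slit need no limit
of the branch. -/
theorem continuous_sinReArcsin : Continuous sinReArcsin := by
  unfold sinReArcsin
  refine Continuous.div (by fun_prop) (by fun_prop) fun z => ?_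
  linarith [two_le_norm_add_one_add_norm_sub_one z]

theorem sinReArcsin_eq_zero {z : ℂ} (hz : z.re = 0) : sinReArcsin z = 0 := by
  simp [sinReArcsin, hz]

theorem sinReArcsin_ofReal {t : ℝ} (ht : 0 ≤ t) : sinReArcsin t = 2 * t / (t + 1 + |t - 1|) := by
  have h1 : ‖(t : ℂ) + 1‖ = t + 1 := by
    rw [← ofReal_one, ← ofReal_add, norm_real, Real.norm_of_nonneg (by linarith)]
  have h2 : ‖(t : ℂ) - 1‖ = |t - 1| := by
    rw [← ofReal_one, ← ofReal_sub, norm_real, Real.norm_eq_abs]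
  rw [sinReArcsin, h1, h2, ofReal_re]

theorem sinReArcsin_of_one_le {t : ℝ} (ht : 1 ≤ t) : sinReArcsin t = 1 := by
  rw [sinReArcsin_ofReal (by linarith), abs_of_nonneg (by linarith),
    div_eq_one_iff_eq (by linarith)]
  ring

theorem sinReArcsin_of_le_one {t : ℝ} (h0 : 0 ≤ t) (ht : t ≤ 1) : sinReArcsin t = t := by
  rw [sinReArcsin_ofReal h0, abs_of_nonpos (by linarith)]
  ring

theorem norm_sin_add_one (g : ℂ) : ‖sin g + 1‖ = Real.cosh g.im + Real.sin g.re := by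
  have h0 : 0 ≤ Real.cosh g.im + Real.sin g.re := by
    linarith [Real.one_le_cosh g.im, Real.neg_one_le_sin g.re]
  have hre : (sin g + 1).re = Real.sin g.re * Real.cosh g.im + 1 := by
    rw [sin_eq]
    simp [← ofReal_sin, ← ofReal_cosh, ← ofReal_cos, ← ofReal_sinh]
  have him : (sin g + 1).im = Real.cos g.re * Real.sinh g.im := by
    rw [sin_eq]
    simp [← ofReal_sin, ← ofReal_cosh, ← ofReal_cos, ← ofReal_sinh]
  rw [← sq_eq_sq₀ (norm_nonneg _) h0, ← normSq_eq_norm_sq, normSq_apply, hre, him]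
  have h1 := Real.sin_sq_add_cos_sq g.re
  have h2 := Real.cosh_sq g.im
  have h3 : Real.cos g.re ^ 2 = 1 - Real.sin g.re ^ 2 := by linarith
  have h4 : Real.sinh g.im ^ 2 = Real.cosh g.im ^ 2 - 1 := by linarith
  linear_combination Real.sinh g.im ^ 2 * h3 + (1 - Real.sin g.re ^ 2) * h4

theorem norm_sin_sub_one (g : ℂ) : ‖sin g - 1‖ = Real.cosh g.im - Real.sin g.re := by
  have h := norm_sin_add_one (-g)
  rw [sin_neg, neg_im, neg_re, Real.cosh_neg, Real.sin_neg] at h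
  rw [← norm_neg, neg_sub, sub_eq_add_neg, add_comm, h, sub_eq_add_neg]

/-- Elliptic coordinates with foci `±1`: the distances from `sin g` to the foci add up to `2 cosh
(Im g)`. -/
theorem sinReArcsin_sin (g : ℂ) : sinReArcsin (sin g) = Real.sin g.re := by
  have hre : (sin g).re = Real.sin g.re * Real.cosh g.im := by
    rw [sin_eq]
    simp [← ofReal_sin, ← ofReal_cosh, ← ofReal_cos, ← ofReal_sinh]
  have hpos := Real.cosh_pos g.im
  rw [sinReArcsin, norm_sin_add_one, norm_sin_sub_one, hre,
    div_eq_iff (by linarith)]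
  ring

/-- The principal branch of the complex arcsine. -/
noncomputable def complexArcsin (z : ℂ) : ℂ :=
  -I * log (exp (log (1 - z ^ 2) / 2) + I * z)

section Arcsin

variable {z : ℂ}

theorem sqrt_add_mul_sqrt_sub (hz : 1 - z ^ 2 ∈ slitPlane) :
    (exp (log (1 - z ^ 2) / 2) + I * z) * (exp (log (1 - z ^ 2) / 2) - I * z) = 1 := by
  have h : exp (log (1 - z ^ 2) / 2) ^ 2 = 1 - z ^ 2 := by
    rw [← exp_nat_mul]
    push_cast
    rw [mul_div_cancel₀ _ two_ne_zero, exp_log (slitPlane_ne_zero hz)]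
  linear_combination h - z ^ 2 * I_sq

/-- `p = √(1 - z²) + I z` has inverse `√(1 - z²) - I z`. The real parts of `p` and `p⁻¹` share a
sign and sum to `2 Re √(1 - z²) > 0`. -/
theorem re_sqrt_add_pos (hz : 1 - z ^ 2 ∈ slitPlane) :
    0 < (exp (log (1 - z ^ 2) / 2) + I * z).re := by
  set q := exp (log (1 - z ^ 2) / 2) with hq
  have hqre : 0 < q.re := by
    rw [hq, exp_re]
    refine mul_pos (Real.exp_pos _) (Real.cos_pos_of_mem_Ioo ?_)
    have h1 := (mem_slitPlane_iff_arg.1 hz).1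
    have h2 := neg_pi_lt_arg (1 - z ^ 2)
    have h3 := (arg_le_pi (1 - z ^ 2)).lt_of_ne h1
    have h4 : (log (1 - z ^ 2) / 2).im = arg (1 - z ^ 2) / 2 := by
      rw [show (2 : ℂ) = ((2 : ℝ) : ℂ) by norm_num, div_ofReal_im, log_im]
    rw [h4]
    constructor <;> linarith
  have hmul := sqrt_add_mul_sqrt_sub hz
  rw [← hq] at hmul
  set p := q + I * z with hp
  have hinv : q - I * z = p⁻¹ := eq_inv_of_mul_eq_one_right hmul
  have hp0 : p ≠ 0 := left_ne_zero_of_mul_eq_one hmul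
  have hsum : p.re + p⁻¹.re = 2 * q.re := by
    rw [← hinv, hp]
    simp
    ring
  rw [inv_re, div_eq_mul_inv] at hsum
  have hN : 0 < 1 + (normSq p)⁻¹ := by
    have := normSq_nonneg p
    positivity
  by_contra! hneg
  nlinarith [mul_nonneg (neg_nonneg.2 hneg) hN.le]

theorem sin_complexArcsin (hz : 1 - z ^ 2 ∈ slitPlane) : sin (complexArcsin z) = z := by
  have hmul := sqrt_add_mul_sqrt_sub hz
  have hinv := eq_inv_of_mul_eq_one_right hmul
  have hp0 := left_ne_zero_of_mul_eq_one hmul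
  have h1 : complexArcsin z * I = log (exp (log (1 - z ^ 2) / 2) + I * z) := by
    unfold complexArcsin
    linear_combination -log (exp (log (1 - z ^ 2) / 2) + I * z) * I_sq
  rw [sin, neg_mul, h1, Complex.exp_neg, exp_log hp0, ← hinv]
  linear_combination -z * I_sq

theorem complexArcsin_re (hz : 1 - z ^ 2 ∈ slitPlane) :
    (complexArcsin z).re = Real.arcsin (sinReArcsin z) := by
  have harg : (complexArcsin z).re = arg (exp (log (1 - z ^ 2) / 2) + I * z) := by
    simp [complexArcsin, log_im]
  have h := abs_arg_lt_pi_div_two_iff.2 (Or.inl (re_sqrt_add_pos hz))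
  rw [← harg, abs_lt] at h
  conv_rhs => rw [← sin_complexArcsin hz, sinReArcsin_sin]
  rw [Real.arcsin_sin h.1.le h.2.le]

theorem analyticAt_complexArcsin (hz : 1 - z ^ 2 ∈ slitPlane) :
    AnalyticAt ℂ complexArcsin z := by
  have h1 : AnalyticAt ℂ (fun z : ℂ => log (1 - z ^ 2)) z :=
    AnalyticAt.clog (by fun_prop) hz
  have h2 : AnalyticAt ℂ (fun z : ℂ => exp (log (1 - z ^ 2) / 2)) z :=
    (h1.div analyticAt_const two_ne_zero).cexp
  have h3 : AnalyticAt ℂ (fun z : ℂ => exp (log (1 - z ^ 2) / 2) + I * z) z :=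
    h2.add (analyticAt_const.mul analyticAt_id)
  exact analyticAt_const.mul (h3.clog (Or.inl (re_sqrt_add_pos hz)))

end Arcsin

/-! ### The explicit harmonic measure -/

/-- The harmonic measure `(2 / π) Re arcsin (sinh (n k₀) / sinh (n k))` of the slit half-strip. -/
noncomputable def slitHarmonicMeasure (n : ℕ) (k₀ : ℝ) (k : ℂ) : ℝ :=
  2 / Real.pi * Real.arcsin (sinReArcsin (Real.sinh (n * k₀) / sinh (n * k)))

section SlitHarmonicMeasure

variable {n : ℕ} {k₀ : ℝ} {k : ℂ}

theorem sinh_natCast_mul_re (n : ℕ) (k : ℂ) :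
    (sinh (n * k)).re = Real.sinh (n * k.re) * Real.cos (n * k.im) := by
  have : (n : ℂ) * k = ((n * k.re : ℝ) : ℂ) + ((n * k.im : ℝ) : ℂ) * I := by
    apply Complex.ext <;> simp
  rw [this, sinh_add, sinh_mul_I, cosh_mul_I]
  simp [← ofReal_sin, ← ofReal_cosh, ← ofReal_cos, ← ofReal_sinh, -ofReal_mul]

theorem sinh_natCast_mul_im (n : ℕ) (k : ℂ) :
    (sinh (n * k)).im = Real.cosh (n * k.re) * Real.sin (n * k.im) := by
  have : (n : ℂ) * k = ((n * k.re : ℝ) : ℂ) + ((n * k.im : ℝ) : ℂ) * I := by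
    apply Complex.ext <;> simp
  rw [this, sinh_add, sinh_mul_I, cosh_mul_I]
  simp [← ofReal_sin, ← ofReal_cosh, ← ofReal_cos, ← ofReal_sinh, -ofReal_mul]

theorem abs_natCast_mul_le (hn : 1 ≤ n) {y : ℝ} (h : |y| ≤ Real.pi / (2 * (n : ℝ))) :
    |n * y| ≤ Real.pi / 2 := by
  have hn' : (0 : ℝ) < n := by exact_mod_cast hn
  rw [abs_mul, Nat.abs_cast]
  calc (n : ℝ) * |y| ≤ n * (Real.pi / (2 * n)) := by gcongr
    _ = Real.pi / 2 := by field_simp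

theorem abs_natCast_mul_lt (hn : 1 ≤ n) {y : ℝ} (h : |y| < Real.pi / (2 * (n : ℝ))) :
    |n * y| < Real.pi / 2 := by
  have hn' : (0 : ℝ) < n := by exact_mod_cast hn
  rw [abs_mul, Nat.abs_cast]
  calc (n : ℝ) * |y| < n * (Real.pi / (2 * n)) := by gcongr
    _ = Real.pi / 2 := by field_simp

theorem sinh_natCast_mul_ne_zero (hn : 1 ≤ n) (hk : k ∈ closure (halfStrip n)) (h0 : k ≠ 0) :
    sinh (n * k) ≠ 0 := by
  intro h
  have hn' : (0 : ℝ) < n := by exact_mod_cast hn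
  have hkc := closure_halfStrip_subset n hk
  have him := sinh_natCast_mul_im n k
  have hre := sinh_natCast_mul_re n k
  rw [h, zero_im, eq_comm, mul_eq_zero, or_iff_right (Real.cosh_pos _).ne'] at him
  have hy := abs_le.1 (abs_natCast_mul_le hn hkc.2)
  have hy0 : n * k.im = 0 :=
    (Real.sin_eq_zero_iff_of_lt_of_lt (by linarith [Real.pi_pos]) (by linarith [Real.pi_pos])).1 him
  rw [h, zero_re, hy0, Real.cos_zero, mul_one, eq_comm, Real.sinh_eq_zero] at hre
  exact h0 (Complex.ext (by simpa [hn'.ne'] using hre) (by simpa [hn'.ne'] using hy0))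

/-- Since `Re z > 0`, `1 - z²` can lie on the cut only if `z` is real and `z ≥ 1`; then `sinh (n k)`
is real and at most `sinh (n k₀)`, which puts `k` on the slit. -/
theorem one_sub_sq_mem_slitPlane (hn : 1 ≤ n) (hk₀ : 0 < k₀) (hk : k ∈ halfStrip n \ slit k₀) :
    1 - ((Real.sinh (n * k₀) : ℂ) / sinh (n * k)) ^ 2 ∈ slitPlane := by
  have hn' : (0 : ℝ) < n := by exact_mod_cast hn
  have hk0 : k ≠ 0 := by
    rintro rfl
    simpa using hk.1.1
  have hs := sinh_natCast_mul_ne_zero hn (subset_closure hk.1) hk0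
  have hX : 0 < Real.sinh (n * k₀) := Real.sinh_pos_iff.2 (by positivity)
  have hy := abs_lt.1 (abs_natCast_mul_lt hn hk.1.2)
  have hre : 0 < (sinh (n * k)).re := by
    rw [sinh_natCast_mul_re]
    exact mul_pos (Real.sinh_pos_iff.2 (mul_pos hn' hk.1.1)) (Real.cos_pos_of_mem_Ioo hy)
  set s := sinh (n * k) with hsdef
  set X := Real.sinh (n * k₀) with hXdef
  set z := (X : ℂ) / s with hz
  have hzs : z * s = X := by rw [hz, div_mul_cancel₀ _ hs]
  have hzre : 0 < z.re := by
    rw [hz, div_re, ofReal_re, ofReal_im]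
    have := normSq_pos.2 hs
    simp only [zero_mul, zero_div, add_zero]
    positivity
  rw [mem_slitPlane_iff]
  by_contra! hcon
  obtain ⟨h1, h2⟩ := hcon
  have e1 : (1 - z ^ 2).re = 1 - (z.re ^ 2 - z.im ^ 2) := by
    simp [pow_two]
  have e2 : (1 - z ^ 2).im = -(2 * z.re * z.im) := by
    simp [pow_two]; ring
  rw [e2] at h2
  have hzim : z.im = 0 := by
    have : z.re * z.im = 0 := by linarith
    exact (mul_eq_zero.1 this).resolve_left hzre.ne'
  rw [e1, hzim] at h1
  have hz1 : 1 ≤ z.re := by nlinarith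
  have m1 : z.re * s.re = X := by
    have := congrArg re hzs
    simpa [hzim] using this
  have m2 : s.im = 0 := by
    have := congrArg im hzs
    simp [hzim] at this
    exact this.resolve_left hzre.ne'
  rw [hsdef, sinh_natCast_mul_im, mul_eq_zero, or_iff_right (Real.cosh_pos _).ne'] at m2
  have hy0 : n * k.im = 0 :=
    (Real.sin_eq_zero_iff_of_lt_of_lt (by linarith [Real.pi_pos]) (by linarith [Real.pi_pos])).1 m2
  have hsre : s.re = Real.sinh (n * k.re) := by
    rw [hsdef, sinh_natCast_mul_re, hy0, Real.cos_zero, mul_one]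
  have hle : s.re ≤ X := by nlinarith
  rw [hsre, hXdef, Real.sinh_le_sinh] at hle
  exact hk.2 ⟨hk.1.1.le, le_of_mul_le_mul_left hle hn', by simpa [hn'.ne'] using hy0⟩

theorem harmonicOnNhd_slitHarmonicMeasure (hn : 1 ≤ n) (hk₀ : 0 < k₀) :
    HarmonicOnNhd (slitHarmonicMeasure n k₀) (halfStrip n \ slit k₀) := by
  intro k hk
  have hk0 : k ≠ 0 := by
    rintro rfl
    simpa using hk.1.1
  have hs := sinh_natCast_mul_ne_zero hn (subset_closure hk.1) hk0
  have hsa : AnalyticAt ℂ (fun k : ℂ => sinh (n * k)) k :=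
    (by fun_prop : Differentiable ℂ fun k : ℂ => sinh (n * k)).analyticAt k
  have hza : AnalyticAt ℂ (fun k : ℂ => (Real.sinh (n * k₀) : ℂ) / sinh (n * k)) k :=
    analyticAt_const.div hsa hs
  have hA := (analyticAt_complexArcsin (one_sub_sq_mem_slitPlane hn hk₀ hk)).comp_of_eq
    (f := fun k : ℂ => (Real.sinh (n * k₀) : ℂ) / sinh (n * k)) hza rfl
  have hre := hA.harmonicAt_re.const_smul (c := 2 / Real.pi)
  refine (harmonicAt_congr_nhds ?_).1 hre
  filter_upwards [((isOpen_halfStrip n).sdiff (isClosed_slit k₀)).mem_nhds hk] with x hx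
  simp only [Pi.smul_apply, smul_eq_mul, Function.comp_apply, slitHarmonicMeasure]
  rw [complexArcsin_re (one_sub_sq_mem_slitPlane hn hk₀ hx)]

theorem slitHarmonicMeasure_ofReal (n : ℕ) (k₀ k : ℝ) : slitHarmonicMeasure n k₀ k =
    2 / Real.pi * Real.arcsin (sinReArcsin ((Real.sinh (n * k₀) / Real.sinh (n * k) : ℝ) : ℂ)) := by
  rw [slitHarmonicMeasure]
  push_cast
  rfl

theorem slitHarmonicMeasure_eq_one (hn : 1 ≤ n) {k : ℝ} (h0 : 0 < k) (hk : k ≤ k₀) :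
    slitHarmonicMeasure n k₀ k = 1 := by
  have hn' : (0 : ℝ) < n := by exact_mod_cast hn
  have h1 : 1 ≤ Real.sinh (n * k₀) / Real.sinh (n * k) := by
    rw [one_le_div (Real.sinh_pos_iff.2 (by positivity)), Real.sinh_le_sinh]
    gcongr
  rw [slitHarmonicMeasure_ofReal, sinReArcsin_of_one_le h1, Real.arcsin_one]
  field_simp

theorem isHarmonicMeasure_slitHarmonicMeasure (hn : 1 ≤ n) (hk₀ : 0 < k₀) :
    IsHarmonicMeasure n k₀ (slitHarmonicMeasure n k₀) where
  harmonic := harmonicOnNhd_slitHarmonicMeasure hn hk₀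
  continuousOn := by
    have hz : ContinuousOn (fun k : ℂ => (Real.sinh (n * k₀) : ℂ) / sinh (n * k))
        (closure (halfStrip n) \ {0}) :=
      continuousOn_const.div (by fun_prop) fun k hk => sinh_natCast_mul_ne_zero hn hk.1 hk.2
    exact continuousOn_const.mul
      ((Real.continuous_arcsin.comp continuous_sinReArcsin).comp_continuousOn hz)
  bounded := by
    refine ⟨1, fun k _ => ?_⟩
    rw [slitHarmonicMeasure, abs_mul, abs_of_pos (by positivity), div_mul_eq_mul_div,
      div_le_one Real.pi_pos]
    have := abs_le.2 ⟨Real.neg_pi_div_two_le_arcsin _, Real.arcsin_le_pi_div_two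
      (sinReArcsin (Real.sinh (n * k₀) / sinh (n * k)))⟩
    linarith
  eq_zero := by
    intro k hk
    have hn' : (0 : ℝ) < n := by exact_mod_cast hn
    rw [(isOpen_halfStrip n).frontier_eq] at hk
    have hkc := closure_halfStrip_subset n hk.1
    have hre : (sinh (n * k)).re = 0 := by
      rw [sinh_natCast_mul_re, mul_eq_zero]
      rcases hkc.1.eq_or_lt with h | h
      · left
        simp [← h]
      · right
        have hy : |k.im| = Real.pi / (2 * n) :=
          hkc.2.antisymm (not_lt.1 fun hlt => hk.2 ⟨h, hlt⟩)
        rw [← Real.cos_abs, abs_mul, Nat.abs_cast, hy, ← Real.cos_pi_div_two]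
        congr 1
        field_simp
    -- The corner `k = 0` is included, because division by zero gives `0`.
    have hz : ((Real.sinh (n * k₀) : ℂ) / sinh (n * k)).re = 0 := by
      rw [div_re, hre, ofReal_im]
      simp
    rw [slitHarmonicMeasure, sinReArcsin_eq_zero hz, Real.arcsin_zero, mul_zero]
  eq_one := by
    rintro k ⟨⟨h0, h1, h2⟩, hne⟩
    have hk : k = (k.re : ℂ) := Complex.ext (by simp) (by simp [h2])
    have hpos : 0 < k.re := h0.lt_of_ne fun h => hne (Complex.ext h.symm h2)
    rw [hk]
    exact slitHarmonicMeasure_eq_one hn hpos h1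

theorem two_div_pi_mul_sinh_div_sinh_le (hn : 1 ≤ n) (hk₀ : 0 < k₀) {k : ℝ} (hk : k₀ ≤ k) :
    2 / Real.pi * (Real.sinh (n * k₀) / Real.sinh (n * k)) ≤ slitHarmonicMeasure n k₀ k := by
  have hn' : (0 : ℝ) < n := by exact_mod_cast hn
  have hX : 0 < Real.sinh (n * k₀) := Real.sinh_pos_iff.2 (by positivity)
  have hle : Real.sinh (n * k₀) ≤ Real.sinh (n * k) := Real.sinh_le_sinh.2 (by gcongr)
  have hs : 0 < Real.sinh (n * k) := hX.trans_le hle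
  have h0 : 0 ≤ Real.sinh (n * k₀) / Real.sinh (n * k) := by positivity
  have h1 : Real.sinh (n * k₀) / Real.sinh (n * k) ≤ 1 := (div_le_one hs).2 hle
  rw [slitHarmonicMeasure_ofReal, sinReArcsin_of_le_one h0 h1]
  gcongr
  have := Real.sin_le (Real.arcsin_nonneg.2 h0)
  rwa [Real.sin_arcsin (by linarith) h1] at this

end SlitHarmonicMeasure

/-! ### Elementary estimates and conclusion -/

/-- Superadditivity of the `n`-th power gives `(e^k₀ - 1)^n + 1 ≤ e^(n k₀)`, and the `1` absorbs
`e^(-n k₀)`. -/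
theorem exp_sub_one_pow_le_two_mul_sinh {n : ℕ} (hn : 1 ≤ n) {k₀ : ℝ} (hk₀ : 0 ≤ k₀) :
    (Real.exp k₀ - 1) ^ n ≤ 2 * Real.sinh (n * k₀) := by
  have ha : 0 ≤ Real.exp k₀ - 1 := by linarith [Real.one_le_exp hk₀]
  have h1 : (Real.exp k₀ - 1) ^ n + 1 ^ n ≤ (Real.exp k₀ - 1 + 1) ^ n :=
    pow_add_pow_le ha zero_le_one (by omega)
  rw [sub_add_cancel, one_pow, ← Real.exp_nat_mul] at h1
  have h2 : Real.exp (-(n * k₀)) ≤ 1 := Real.exp_le_one_iff.2 (by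
    have : 0 ≤ (n : ℝ) * k₀ := by positivity
    linarith)
  rw [Real.sinh_eq]
  linarith

theorem eta_le_div_three (n : ℕ) {k₀ : ℝ} (hk₀ : 0 ≤ k₀) :
    eta n k₀ ≤ (Real.exp k₀ - 1) ^ n / 3 := by
  have ha : 0 ≤ Real.exp k₀ - 1 := by linarith [Real.one_le_exp hk₀]
  have h1 : 1 ≤ √(1 + (Real.exp k₀ - 1) ^ (2 * n)) := by
    rw [Real.one_le_sqrt]
    linarith [pow_nonneg ha (2 * n)]
  rw [eta]
  gcongr
  linarith

theorem eta_le_half (n : ℕ) {k₀ : ℝ} (hk₀ : 0 ≤ k₀) : eta n k₀ ≤ 1 / 2 := by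
  have ha : 0 ≤ Real.exp k₀ - 1 := by linarith [Real.one_le_exp hk₀]
  have h1 : (Real.exp k₀ - 1) ^ n ≤ √(1 + (Real.exp k₀ - 1) ^ (2 * n)) := by
    refine Real.le_sqrt_of_sq_le ?_
    rw [← pow_mul, mul_comm n 2]
    linarith
  rw [eta, div_le_iff₀ (by positivity)]
  linarith

theorem proposition5p1 (n : ℕ) (hn : 1 ≤ n) (k₀ : ℝ) (hk₀ : 0 < k₀) :
    ∃ w₀ : ℂ → ℝ, IsHarmonicMeasure n k₀ w₀ ∧
      (∀ v : ℂ → ℝ, IsHarmonicMeasure n k₀ v → Set.EqOn v w₀ (closure (halfStrip n))) ∧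
      ∀ k : ℝ, 0 < k →
        w₀ (k : ℂ) ≥ 6 / Real.pi * eta n k₀ * Real.exp (-((n : ℝ) * k)) := by
  have hw := isHarmonicMeasure_slitHarmonicMeasure hn hk₀
  refine ⟨slitHarmonicMeasure n k₀, hw, fun v hv => hv.eqOn_closure hn hw, fun k hk => ?_⟩
  have hn' : (0 : ℝ) < n := by exact_mod_cast hn
  rcases le_total k k₀ with h | h
  · rw [slitHarmonicMeasure_eq_one hn hk h]
    have hexp : Real.exp (-((n : ℝ) * k)) ≤ 1 := Real.exp_le_one_iff.2 (by
      have : 0 < (n : ℝ) * k := by positivity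
      linarith)
    have hpi : 6 / Real.pi * (1 / 2) ≤ 1 := by
      have := Real.pi_gt_three
      rw [div_mul_eq_mul_div, div_le_one Real.pi_pos]
      linarith
    calc 6 / Real.pi * eta n k₀ * Real.exp (-((n : ℝ) * k))
        ≤ 6 / Real.pi * (1 / 2) * 1 := by
          gcongr
          exact eta_le_half n hk₀.le
      _ ≤ 1 := by linarith
  · refine ge_iff_le.2 (le_trans ?_ (two_div_pi_mul_sinh_div_sinh_le hn hk₀ h))
    have hX := exp_sub_one_pow_le_two_mul_sinh hn hk₀.le
    have hη := eta_le_div_three n hk₀.le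
    have hX0 : 0 ≤ Real.sinh (n * k₀) := (Real.sinh_pos_iff.2 (by positivity)).le
    have hs : 0 < Real.sinh (n * k) := Real.sinh_pos_iff.2 (by positivity)
    have hs2 : 2 * Real.sinh (n * k) * Real.exp (-((n : ℝ) * k)) ≤ 1 := by
      rw [Real.sinh_eq, mul_div_cancel₀ _ two_ne_zero, sub_mul, ← Real.exp_add, add_neg_cancel,
        Real.exp_zero]
      linarith [mul_pos (Real.exp_pos (-((n : ℝ) * k))) (Real.exp_pos (-((n : ℝ) * k)))]
    have hexp : Real.exp (-((n : ℝ) * k)) ≤ 1 / (2 * Real.sinh (n * k)) := by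
      rw [le_div_iff₀ (by positivity)]
      linarith
    calc 6 / Real.pi * eta n k₀ * Real.exp (-((n : ℝ) * k))
        ≤ 6 / Real.pi * (2 * Real.sinh (n * k₀) / 3) * (1 / (2 * Real.sinh (n * k))) := by
          gcongr
          linarith
      _ = 2 / Real.pi * (Real.sinh (n * k₀) / Real.sinh (n * k)) := by
          field_simp
          norm_num
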